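/- **Setting.** Let $G=(V,E)$ be a finite network (directed, undirected or mixed) with a source $s$ and a sink $t\neq s$. Every node and every edge $x$ has a capacity $c(x)\in\mathbb N$, and every edge $e$ has a travel time $d(e)\in\mathbb N$. Initially $p\ge 1$ people are at $s$, and some $s$–$t$ path has positive capacity on all its nodes and edges. Paths are simple $s$–$t$ paths; $T(P)$ is the sum of the travel times of the edges of $P$. Paths are ordered by transit time, ties being broken by an arbitrary fixed ranking of the paths, the same for both algorithms; "shortest" refers to this order. **SSEP.** Starting with no paths, repeat while fewer than $p$ paths have been found and $t$ is reachable from $s$ in the remaining network: find the shortest path $P_{i+1}$ in the remaining network, with transit time $T_{i+1}$ and capacity $C_{i+1}$ (the minimum of the remaining capacities of all its nodes and edges). If $i\ge 1$ and $T_{i+1}>CET(S_i)$, where $S_i=\{P_1,\dots,P_i\}$ and $$CET(S_i)=\left\lceil\frac{p+\sum_{l\le i}C_lT_l}{\sum_{l\le i}C_l}\right\rceil-1,$$ stop. Otherwise add $P_{i+1}$, reduce the capacities of its nodes and edges permanently by $C_{i+1}$, and delete those whose capacity has become $0$. If $P_1,\dots,P_k$ are the paths found, send $x_i$ people along $P_i$,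 where $\sum_i x_i=p$ and $T_i+\lceil x_i/C_i\rceil-1\le CET(S_k)$ for all $i$: groups of $C_i$ people (the last one possibly smaller) leave $s$ along $P_i$ at times $0,1,2,\dots$ and travel without delay. **CCRP.** A journey along a path consists of integer arrival and departure times at its nodes; delays at nodes are allowed. It occupies each edge at the time it enters it, and each node from its arrival there until its departure ($s$ only at the departure time, $t$ only at the arrival time). While there are people left at $s$: among all journeys along which every node and edge has positive unreserved capacity at the times at which it is used, choose one with the earliest arrival time at $t$; ties are broken in favour of the earlier path in the order above, and among journeys with the same path and arrival time in favour of the latest departure from $s$. Reserve the chosen journey for a group whose size is the minimum of the number of people left and the available capacities along the journey. The evacuation time of a plan is the time at which its last group reaches $t$. **Theorem.** Both algorithms terminate with a solution that sends all $p$ people. The evacuation time of every solution given by SSEP equals $CET(S_k)$, and it is at most the evacuation time of every solution given by CCRP. -/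

import Mathlib

/-- A capacitated network with one source and one sink. Each edge `e` joins `tail e` to `head e`;
it can be traversed from `tail e` to `head e`, and also backwards if `twoWay e` holds (so directed,
undirected and mixed graphs, possibly with parallel edges, are covered). Capacities are numbers of
people per time unit, travel times are numbers of time units. -/
structure EvacNetwork (V E : Type*) where
  tail : E → V
  head : E → V
  twoWay : E → Prop
  nodeCap : V → ℕ
  edgeCap : E → ℕ
  travel : E → ℕ
  source : V
  sink : V
  source_ne_sink : source ≠ sink

namespace EvacNetwork

variable {V E : Type*}

/-- Edge `e` can be traversed from `u` to `v`. -/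
def Joins (N : EvacNetwork V E) (e : E) (u v : V) : Prop :=
  (u = N.tail e ∧ v = N.head e) ∨ (N.twoWay e ∧ u = N.head e ∧ v = N.tail e)

/-- A (simple) path from the source to the sink, given by its nodes and its edges. -/
structure Route (N : EvacNetwork V E) where
  len : ℕ
  node : Fin (len + 1) → V
  edge : Fin len → E
  node_injective : Function.Injective node
  node_zero : node 0 = N.source
  node_last : node (Fin.last len) = N.sink
  joins : ∀ i : Fin len, N.Joins (edge i) (node i.castSucc) (node i.succ)

variable {N : EvacNetwork V E}

/-- The transit time `T(P)`. -/
def Route.transit (P : N.Route) : ℕ := ∑ i, N.travel (P.edge i)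

/-- The time needed to reach the `i`-th node of `P` without delay. -/
def Route.elapsed (P : N.Route) (i : Fin (P.len + 1)) : ℕ :=
  ∑ j : Fin P.len with j.castSucc < i, N.travel (P.edge j)

/-! ### The SSEP algorithm -/

/-- The paths found so far, in order of discovery, each with its capacity at discovery. -/
abbrev RouteList (N : EvacNetwork V E) := List (N.Route × ℕ)

open Classical in
/-- Remaining capacity of a node after the permanent reductions along the paths of `R`. -/
noncomputable def nodeLeft (R : N.RouteList) (v : V) : ℕ :=
  N.nodeCap v - (R.map fun q => if ∃ i, q.1.node i = v then q.2 else 0).sum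

open Classical in
/-- Remaining capacity of an edge after the permanent reductions along the paths of `R`. -/
noncomputable def edgeLeft (R : N.RouteList) (e : E) : ℕ :=
  N.edgeCap e - (R.map fun q => if ∃ i, q.1.edge i = e then q.2 else 0).sum

/-- The capacity of a path in the network that remains after `R`: the minimum of the remaining
capacities of its nodes and edges. -/
noncomputable def routeCap (R : N.RouteList) (P : N.Route) : ℕ :=
  sInf ({c | ∃ i, c = nodeLeft R (P.node i)} ∪ {c | ∃ i, c = edgeLeft R (P.edge i)})

/-- Shortest-path priority: smaller transit time first, ties broken by the fixed ranking. -/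
def routeKey (rank : N.Route → ℕ) (P : N.Route) : ℕ ×ₗ ℕ :=
  toLex (P.transit, rank P)

/-- `P` is the shortest path in the graph that remains after `R`. The saturated nodes and edges of
a path are those whose capacity drops to `0` when the path is added, so a path avoids all deleted
nodes and edges exactly when its remaining capacity is positive. -/
def IsShortest (rank : N.Route → ℕ) (R : N.RouteList) (P : N.Route) : Prop :=
  0 < routeCap R P ∧ ∀ Q : N.Route, 0 < routeCap R Q → routeKey rank P ≤ routeKey rank Q

/-- The combined evacuation time of `p` people on the paths of `R`. -/
def cet (p : ℕ) (R : N.RouteList) : ℤ :=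
  ⌈((p : ℚ) + (R.map fun q => (q.2 : ℚ) * q.1.transit).sum) / (R.map fun q => (q.2 : ℚ)).sum⌉ - 1

/-- The values of the route list during the main loop of SSEP. The initial value `∞` of `CET` is
accounted for by the alternative `R = []`. -/
inductive SSEPReaches (rank : N.Route → ℕ) (p : ℕ) : N.RouteList → Prop
  | init : SSEPReaches rank p []
  | add (R : N.RouteList) (P : N.Route) (hR : SSEPReaches rank p R) (hp : R.length < p)
      (hP : IsShortest rank R P) (hT : R = [] ∨ (P.transit : ℤ) ≤ cet p R) :
      SSEPReaches rank p (R ++ [(P, routeCap R P)])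

/-- The main loop of SSEP stops: `p` paths are found, or the sink is no longer reachable, or the
transit time of the next path exceeds `CET`. -/
def SSEPStops (rank : N.Route → ℕ) (p : ℕ) (R : N.RouteList) : Prop :=
  p ≤ R.length ∨ (¬ ∃ P : N.Route, 0 < routeCap R P) ∨
    ∃ P, IsShortest rank R P ∧ R ≠ [] ∧ cet p R < P.transit

/-- The number of groups in which `x` people travel along a path of capacity `c`. -/
def numGroups (x c : ℕ) : ℕ := ⌈(x : ℚ) / c⌉₊

/-- A solution of SSEP: the routes found by the main loop, together with the numbers `x i` of
people sent along them, all of whom arrive by the time `CET`. -/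
structure IsSSEPSolution (rank : N.Route → ℕ) (p : ℕ) (R : N.RouteList)
    (x : Fin R.length → ℕ) : Prop where
  reaches : SSEPReaches rank p R
  stops : SSEPStops rank p R
  sum_eq : ∑ i, x i = p
  time_le : ∀ i, ((R.get i).1.transit : ℤ) + numGroups (x i) (R.get i).2 - 1 ≤ cet p R

/-! ### Evacuation plans -/

/-- A journey from the source to the sink along a path, with arrival and departure times at its
nodes. Delays at nodes are allowed; a journey starts when it leaves the source and ends when it
reaches the sink. -/
structure Trip (N : EvacNetwork V E) where
  route : N.Route
  arr : Fin (route.len + 1) → ℕ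
  dep : Fin (route.len + 1) → ℕ
  arr_le_dep : ∀ i, arr i ≤ dep i
  dep_zero : dep 0 = arr 0
  dep_last : dep (Fin.last route.len) = arr (Fin.last route.len)
  move : ∀ i : Fin route.len, arr i.succ = dep i.castSucc + N.travel (route.edge i)

/-- The time at which a journey leaves the source. -/
def Trip.start (x : N.Trip) : ℕ := x.dep 0

/-- The destination arrival time of a journey. -/
def Trip.arrival (x : N.Trip) : ℕ := x.arr (Fin.last x.route.len)

/-- The journey along `P` that leaves the source at time `δ` and is never delayed on the way. -/
def Route.direct (P : N.Route) (δ : ℕ) : N.Trip where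
  route := P
  arr i := δ + P.elapsed i
  dep i := δ + P.elapsed i
  arr_le_dep _ := le_rfl
  dep_zero := rfl
  dep_last := rfl
  move i := by
    have h : (Finset.univ.filter fun j : Fin P.len => j.castSucc < i.succ) =
        insert i (Finset.univ.filter fun j : Fin P.len => j.castSucc < i.castSucc) := by
      ext j
      simp only [Finset.mem_filter, Finset.mem_univ, true_and, Finset.mem_insert, Fin.lt_def,
        Fin.ext_iff, Fin.val_castSucc, Fin.val_succ]
      omega
    have h' : P.elapsed i.succ = N.travel (P.edge i) + P.elapsed i.castSucc := by
      unfold Route.elapsed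
      rw [h, Finset.sum_insert (by simp)]
    rw [h']
    omega

/-- An evacuation plan: journeys with the sizes of the groups that make them. -/
abbrev Plan (N : EvacNetwork V E) := List (N.Trip × ℕ)

/-- The number of people who travel in a plan. -/
def Plan.people (L : N.Plan) : ℕ := (L.map fun q => q.2).sum

/-- The evacuation time of a plan: the time at which its last group arrives. -/
def Plan.evacTime (L : N.Plan) : ℕ := (L.map fun q => q.1.arrival).foldr max 0

/-- The plan of an SSEP solution: along the `i`-th path, of capacity `c`, groups of `c` people
(the last one possibly smaller) leave at the times `0, 1, 2, …` until `x i` people are sent. -/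
def ssepPlan (R : N.RouteList) (x : Fin R.length → ℕ) : N.Plan :=
  (List.finRange R.length).flatMap fun i =>
    (List.range (numGroups (x i) (R.get i).2)).map fun j =>
      ((R.get i).1.direct j, min (R.get i).2 (x i - j * (R.get i).2))

/-! ### The CCRP algorithm -/

open Classical in
/-- Capacity of node `v` not reserved at time `τ`. A journey occupies a node from its arrival
there to its departure. -/
noncomputable def nodeFree (L : N.Plan) (v : V) (τ : ℕ) : ℕ :=
  N.nodeCap v -
    (L.map fun q => if ∃ i, q.1.route.node i = v ∧ q.1.arr i ≤ τ ∧ τ ≤ q.1.dep i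
      then q.2 else 0).sum

open Classical in
/-- Capacity of edge `e` not reserved by groups that enter it at time `τ`. -/
noncomputable def edgeFree (L : N.Plan) (e : E) (τ : ℕ) : ℕ :=
  N.edgeCap e -
    (L.map fun q => if ∃ i : Fin q.1.route.len, q.1.route.edge i = e ∧ q.1.dep i.castSucc = τ
      then q.2 else 0).sum

/-- The capacity available for a journey, given the reservations of `L`. -/
noncomputable def tripCap (L : N.Plan) (x : N.Trip) : ℕ :=
  sInf ({c | ∃ i τ, x.arr i ≤ τ ∧ τ ≤ x.dep i ∧ c = nodeFree L (x.route.node i) τ} ∪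
    {c | ∃ i : Fin x.route.len, c = edgeFree L (x.route.edge i) (x.dep i.castSucc)})

/-- CCRP looks for the earliest destination arrival time. Ties are broken by the priority of the
paths (transit time, then ranking), and then in favour of waiting at the source rather than on
the way. -/
def tripKey (rank : N.Route → ℕ) (x : N.Trip) : ℕ ×ₗ (ℕ ×ₗ ℕ) ×ₗ ℕ :=
  toLex (x.arrival, toLex (routeKey rank x.route, x.arrival - x.start))

/-- `x` is the journey selected by CCRP, given the reservations of `L`. -/
def IsCCRPChoice (rank : N.Route → ℕ) (L : N.Plan) (x : N.Trip) : Prop :=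
  0 < tripCap L x ∧ ∀ y : N.Trip, 0 < tripCap L y → tripKey rank x ≤ tripKey rank y

/-- The reservations made during a run of CCRP for `p` people. -/
inductive CCRPReaches (rank : N.Route → ℕ) (p : ℕ) : N.Plan → Prop
  | init : CCRPReaches rank p []
  | reserve (L : N.Plan) (x : N.Trip) (hL : CCRPReaches rank p L) (hp : L.people < p)
      (hx : IsCCRPChoice rank L x) :
      CCRPReaches rank p (L ++ [(x, min (p - L.people) (tripCap L x))])

/-- A solution of CCRP: a run after which nobody is left at the source. -/
def IsCCRPSolution (rank : N.Route → ℕ) (p : ℕ) (L : N.Plan) : Prop :=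
  CCRPReaches rank p L ∧ L.people = p

end EvacNetwork

/-!
Let SSEP go on, regardless of its stopping rules, until the sink is cut off from the source; the
paths it returns are an initial part of the resulting list `G`. If the shortest remaining path meets
another remaining path at a node or an edge, then it gets there no later and needs no longer from
there to the sink, as otherwise switching between the two would give a shorter path. Hence CCRP
sends an undelayed group, filling the path to its capacity at discovery, along every path of `G` at
every departure time, in the order of arrival times and then of positions in `G`: when it comes to
the `l`-th path, the earlier groups at a common node or edge at the relevant time are one for each
earlier path of `G` through it, which leaves exactly the capacity that SSEP sees.

So if CCRP finishes at time `z`, then `p` is at most the sum of `C_l * (z + 1 - T_l)` over the paths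
of `G` with `T_l ≤ z`, whereas `CET` is the least `z` for which this holds for the paths of SSEP.
For `z < CET` the two sums agree, because every path that SSEP leaves out takes at least `CET`.
-/

namespace EvacNetwork

variable {V E : Type*} {N : EvacNetwork V E} {rank : N.Route → ℕ}

/-! ### Undelayed journeys -/

theorem Route.elapsed_zero (P : N.Route) : P.elapsed 0 = 0 := by
  simp [Route.elapsed]

theorem Route.elapsed_succ (P : N.Route) (i : Fin P.len) :
    P.elapsed i.succ = P.elapsed i.castSucc + N.travel (P.edge i) := by
  simpa [Route.direct] using (P.direct 0).move i

theorem Route.elapsed_last (P : N.Route) : P.elapsed (Fin.last P.len) = P.transit := by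
  simp [Route.elapsed, Route.transit, Fin.castSucc_lt_last]

theorem Route.start_direct (P : N.Route) (δ : ℕ) : (P.direct δ).start = δ := by
  change δ + P.elapsed 0 = δ
  rw [P.elapsed_zero, add_zero]

theorem Route.arrival_direct (P : N.Route) (δ : ℕ) : (P.direct δ).arrival = δ + P.transit := by
  simp [Trip.arrival, Route.direct, P.elapsed_last]

theorem Trip.start_add_elapsed_le_arr (x : N.Trip) (i : Fin (x.route.len + 1)) :
    x.start + x.route.elapsed i ≤ x.arr i := by
  induction i using Fin.induction with
  | zero => simp [Route.elapsed_zero, Trip.start, x.dep_zero]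
  | succ i ih =>
    have := x.arr_le_dep i.castSucc
    rw [x.move, Route.elapsed_succ]
    omega

theorem Trip.dep_add_transit_le (x : N.Trip) (i : Fin (x.route.len + 1)) :
    x.dep i + x.route.transit ≤ x.arrival + x.route.elapsed i := by
  induction i using Fin.reverseInduction with
  | last => rw [x.dep_last, Route.elapsed_last, Trip.arrival]
  | cast i ih =>
    have := x.arr_le_dep i.succ
    rw [x.move] at this
    rw [Route.elapsed_succ] at ih
    omega

theorem Trip.start_add_transit_le_arrival (x : N.Trip) :
    x.start + x.route.transit ≤ x.arrival := by
  simpa [Route.elapsed_zero, Trip.start] using x.dep_add_transit_le 0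

theorem Trip.eq_direct_of_arrival_le (x : N.Trip) (h : x.arrival ≤ x.start + x.route.transit) :
    x = x.route.direct x.start := by
  have tight (i) : x.arr i = x.start + x.route.elapsed i ∧
      x.dep i = x.start + x.route.elapsed i := by
    have := x.start_add_elapsed_le_arr i
    have := x.arr_le_dep i
    have := x.dep_add_transit_le i
    omega
  have harr := funext fun i => (tight i).1
  have hdep := funext fun i => (tight i).2
  generalize x.start = δ at harr hdep
  obtain ⟨P, arr, dep, _, _, _, _⟩ := x
  dsimp only at harr hdep
  subst harr hdep
  rfl

theorem Trip.eq_direct_of_tripKey_eq (hrank : Function.Injective rank) {x : N.Trip} {P : N.Route}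
    {δ : ℕ} (h : tripKey rank x = tripKey rank (P.direct δ)) : x = P.direct δ := by
  have harrival : x.arrival = (P.direct δ).arrival := congrArg (fun k => (ofLex k).1) h
  have hroute : x.route = P := hrank (congrArg (fun k => (ofLex (ofLex (ofLex k).2).1).2) h)
  have hduration : x.arrival - x.start = (P.direct δ).arrival - (P.direct δ).start :=
    congrArg (fun k => (ofLex (ofLex k).2).2) h
  have hle := x.start_add_transit_le_arrival
  subst hroute
  rw [Route.arrival_direct] at harrival hduration
  rw [Route.start_direct] at hduration
  obtain rfl : x.start = δ := by omega
  exact x.eq_direct_of_arrival_le harrival.le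

/-! ### Nodes and edges as resources -/

/-- Path `P` reaches the node `v`, or enters the edge `e`, after travelling for time `t`. Nodes and
edges share the role of a capacitated resource, hence the sum type. -/
def Route.Uses (P : N.Route) : V ⊕ E → ℕ → Prop
  | .inl v, t => ∃ i, P.node i = v ∧ P.elapsed i = t
  | .inr e, t => ∃ i : Fin P.len, P.edge i = e ∧ P.elapsed i.castSucc = t

/-- Journey `x` takes up capacity of the node or edge at time `θ`, in the sense of the reservations
of CCRP. -/
def Trip.Occupies (x : N.Trip) : V ⊕ E → ℕ → Prop
  | .inl v, θ => ∃ i, x.route.node i = v ∧ x.arr i ≤ θ ∧ θ ≤ x.dep i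
  | .inr e, θ => ∃ i : Fin x.route.len, x.route.edge i = e ∧ x.dep i.castSucc = θ

/-- The capacity of a node or edge. -/
def capacity (N : EvacNetwork V E) : V ⊕ E → ℕ :=
  Sum.elim N.nodeCap N.edgeCap

/-- The capacity of a node or edge that SSEP has left after finding the paths of `R`. -/
noncomputable def capacityLeft (R : N.RouteList) : V ⊕ E → ℕ :=
  Sum.elim (nodeLeft R) (edgeLeft R)

/-- The capacity of a node or edge that the reservations of `L` leave free at time `θ`. -/
noncomputable def capacityFree (L : N.Plan) (r : V ⊕ E) (θ : ℕ) : ℕ :=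
  r.elim (nodeFree L · θ) (edgeFree L · θ)

open Classical in
theorem capacityLeft_eq (R : N.RouteList) (r : V ⊕ E) :
    capacityLeft R r =
      N.capacity r - (R.map fun q => if ∃ t, q.1.Uses r t then q.2 else 0).sum := by
  cases r <;> simp [capacityLeft, nodeLeft, edgeLeft, capacity, Route.Uses]

open Classical in
theorem capacityFree_eq (L : N.Plan) (r : V ⊕ E) (θ : ℕ) :
    capacityFree L r θ =
      N.capacity r - (L.map fun q => if q.1.Occupies r θ then q.2 else 0).sum := by
  cases r <;> exact congrArg _ (congrArg List.sum (List.map_congr_left fun q _ => by congr))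

theorem routeCap_eq_sInf (R : N.RouteList) (P : N.Route) :
    routeCap R P = sInf {c | ∃ r t, P.Uses r t ∧ c = capacityLeft R r} := by
  rw [routeCap]
  congr 1
  ext c
  constructor
  · rintro (⟨i, h⟩ | ⟨i, h⟩)
    · exact ⟨.inl _, _, ⟨i, rfl, rfl⟩, h⟩
    · exact ⟨.inr _, _, ⟨i, rfl, rfl⟩, h⟩
  · rintro ⟨v | e, t, ⟨i, rfl, -⟩, h⟩
    · exact .inl ⟨i, h⟩
    · exact .inr ⟨i, h⟩

theorem tripCap_eq_sInf (L : N.Plan) (x : N.Trip) :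
    tripCap L x = sInf {c | ∃ r θ, x.Occupies r θ ∧ c = capacityFree L r θ} := by
  rw [tripCap]
  congr 1
  ext c
  constructor
  · rintro (⟨i, τ, h₁, h₂, h⟩ | ⟨i, h⟩)
    · exact ⟨.inl _, τ, ⟨i, rfl, h₁, h₂⟩, h⟩
    · exact ⟨.inr _, _, ⟨i, rfl, rfl⟩, h⟩
  · rintro ⟨v | e, t, hr, h⟩
    · obtain ⟨i, rfl, h₁, h₂⟩ := hr
      exact .inl ⟨i, t, h₁, h₂, h⟩
    · obtain ⟨i, rfl, rfl⟩ := hr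
      exact .inr ⟨i, h⟩

theorem Route.uses_source (P : N.Route) : P.Uses (.inl N.source) 0 :=
  ⟨0, P.node_zero, P.elapsed_zero⟩

theorem routeCap_pos_iff {R : N.RouteList} {P : N.Route} :
    0 < routeCap R P ↔ ∀ r t, P.Uses r t → 0 < capacityLeft R r := by
  rw [routeCap_eq_sInf]
  constructor
  · exact fun h r t hr => h.trans_le (Nat.sInf_le ⟨r, t, hr, rfl⟩)
  · intro h
    obtain ⟨r, t, hr, heq⟩ := Nat.sInf_mem (⟨_, _, _, P.uses_source, rfl⟩ :
      {c | ∃ r t, P.Uses r t ∧ c = capacityLeft R r}.Nonempty)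
    exact heq ▸ h r t hr

theorem routeCap_nil_pos {P : N.Route} (hnode : ∀ i, 0 < N.nodeCap (P.node i))
    (hedge : ∀ i, 0 < N.edgeCap (P.edge i)) : 0 < routeCap [] P := by
  refine routeCap_pos_iff.2 ?_
  rintro (v | e) t ⟨i, rfl, -⟩
  · simpa [capacityLeft, nodeLeft] using hnode i
  · simpa [capacityLeft, edgeLeft] using hedge i

theorem capacityFree_pos_of_occupies {L : N.Plan} {x : N.Trip} (hx : 0 < tripCap L x) {r : V ⊕ E}
    {θ : ℕ} (hr : x.Occupies r θ) : 0 < capacityFree L r θ := by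
  rw [tripCap_eq_sInf] at hx
  exact hx.trans_le (Nat.sInf_le ⟨r, θ, hr, rfl⟩)

theorem Joins.eq_or_swap {e : E} {u v u' v' : V} (h : N.Joins e u v) (h' : N.Joins e u' v') :
    u = u' ∧ v = v' ∨ u = v' ∧ v = u' := by
  unfold Joins at h h'
  grind

theorem Route.edge_injective (P : N.Route) : Function.Injective P.edge := by
  intro i j hij
  rcases (P.joins i).eq_or_swap (hij ▸ P.joins j) with ⟨h, -⟩ | ⟨h, h'⟩
  · exact Fin.castSucc_injective _ (P.node_injective h)
  · have h₁ := congrArg Fin.val (P.node_injective h)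
    have h₂ := congrArg Fin.val (P.node_injective h')
    simp only [Fin.val_castSucc, Fin.val_succ] at h₁ h₂
    omega

theorem Route.Uses.unique {P : N.Route} {r : V ⊕ E} {t t' : ℕ} (h : P.Uses r t)
    (h' : P.Uses r t') : t = t' := by
  rcases r with v | e
  all_goals
    obtain ⟨i, hi, rfl⟩ := h
    obtain ⟨j, hj, rfl⟩ := h'
  · rw [P.node_injective (hi.trans hj.symm)]
  · rw [P.edge_injective (hi.trans hj.symm)]

theorem Trip.exists_occupies {x : N.Trip} {r : V ⊕ E} {t : ℕ} (hr : x.route.Uses r t) :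
    ∃ θ, x.Occupies r θ := by
  rcases r with v | e
  all_goals obtain ⟨i, hi, -⟩ := hr
  · exact ⟨_, i, hi, le_rfl, x.arr_le_dep i⟩
  · exact ⟨_, i, hi, rfl⟩

theorem Trip.Occupies.exists_uses {x : N.Trip} {r : V ⊕ E} {θ : ℕ} (h : x.Occupies r θ) :
    ∃ t, x.route.Uses r t ∧ t ≤ θ ∧ θ + x.route.transit ≤ x.arrival + t := by
  rcases r with v | e
  · obtain ⟨i, hi, harr, hdep⟩ := h
    have := x.start_add_elapsed_le_arr i
    have := x.dep_add_transit_le i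
    exact ⟨_, ⟨i, hi, rfl⟩, by omega, by omega⟩
  · obtain ⟨i, hi, rfl⟩ := h
    have := x.start_add_elapsed_le_arr i.castSucc
    have := x.arr_le_dep i.castSucc
    have := x.dep_add_transit_le i.castSucc
    exact ⟨_, ⟨i, hi, rfl⟩, by omega, by omega⟩

theorem Route.occupies_direct_iff {P : N.Route} {δ : ℕ} {r : V ⊕ E} {θ : ℕ} :
    (P.direct δ).Occupies r θ ↔ ∃ t, P.Uses r t ∧ θ = δ + t := by
  rcases r with v | e <;> constructor
  · rintro ⟨i, hi, harr, hdep⟩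
    exact ⟨_, ⟨i, hi, rfl⟩, le_antisymm hdep harr⟩
  · rintro ⟨_, ⟨i, hi, rfl⟩, rfl⟩
    exact ⟨i, hi, le_rfl, le_rfl⟩
  · rintro ⟨i, hi, h⟩
    exact ⟨_, ⟨i, hi, rfl⟩, h.symm⟩
  · rintro ⟨_, ⟨i, hi, rfl⟩, rfl⟩
    exact ⟨i, hi, rfl⟩

/-! ### Splicing paths -/

/-- The path that follows `P` up to its node `i` and continues along `Q` from its node `j`. -/
def Route.splice (P Q : N.Route) (i : Fin (P.len + 1)) (j : Fin (Q.len + 1))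
    (hij : P.node i = Q.node j) (hdisj : ∀ i' < i, ∀ j' ≥ j, P.node i' ≠ Q.node j') :
    N.Route where
  len := i + (Q.len - j)
  node k := if h : k.val < i then P.node ⟨k, by omega⟩ else Q.node ⟨j + (k - i), by omega⟩
  edge k := if h : k.val < i then P.edge ⟨k, by omega⟩ else Q.edge ⟨j + (k - i), by omega⟩
  node_injective k l hkl := by
    dsimp only at hkl
    split_ifs at hkl with hk hl hl
    · exact Fin.ext (Fin.mk.inj (P.node_injective hkl))
    · exact absurd hkl (hdisj _ hk _ (Nat.le_add_right _ _))
    · exact absurd hkl.symm (hdisj _ hl _ (Nat.le_add_right _ _))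
    · have := Fin.mk.inj (Q.node_injective hkl)
      exact Fin.ext (by omega)
  node_zero := by
    split_ifs with h
    · exact P.node_zero
    · obtain rfl : i = 0 := Fin.ext (by simpa using h)
      simp [← hij, P.node_zero]
  node_last := by
    rw [dif_neg (by simp), ← Q.node_last]
    congr 1
    ext
    simp
    omega
  joins k := by
    rcases lt_trichotomy (k.val + 1) i with h | h | h
    · convert P.joins ⟨k, by omega⟩ using 1
      · exact dif_pos (by omega)
      · exact dif_pos (by simp; omega)
      · exact dif_pos (by simp; omega)
    · convert P.joins ⟨k, by omega⟩ using 1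
      · exact dif_pos (by omega)
      · exact dif_pos (by simp; omega)
      · rw [show Fin.succ (⟨k, by omega⟩ : Fin P.len) = i from Fin.ext h, hij]
        exact (dif_neg (by simp; omega)).trans (congrArg Q.node (Fin.ext (by simp; omega)))
    · convert Q.joins ⟨j + (k - i), by omega⟩ using 1
      · exact dif_neg (by omega)
      · exact dif_neg (by simp; omega)
      · exact (dif_neg (by simp; omega)).trans (congrArg Q.node (Fin.ext (by simp; omega)))

section Splice

variable {P Q : N.Route} {i : Fin (P.len + 1)} {j : Fin (Q.len + 1)} (hij : P.node i = Q.node j)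
  (hdisj : ∀ i' < i, ∀ j' ≥ j, P.node i' ≠ Q.node j')

theorem Route.len_splice : (P.splice Q i j hij hdisj).len = i + (Q.len - j) :=
  rfl

theorem Route.elapsed_splice_of_le {k : ℕ} (hk : k ≤ i) :
    (P.splice Q i j hij hdisj).elapsed ⟨k, by rw [len_splice]; omega⟩ =
      P.elapsed ⟨k, by omega⟩ := by
  induction k with
  | zero => exact (Route.elapsed_zero _).trans P.elapsed_zero.symm
  | succ k ih =>
    have hsplice := (P.splice Q i j hij hdisj).elapsed_succ ⟨k, by rw [len_splice]; omega⟩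
    have hP := P.elapsed_succ ⟨k, by omega⟩
    have hedge : (P.splice Q i j hij hdisj).edge ⟨k, by rw [len_splice]; omega⟩ =
      P.edge ⟨k, by omega⟩ := dif_pos hk
    have := ih (by omega)
    simp only [Fin.succ_mk, Fin.castSucc_mk, hedge] at hsplice hP
    omega

theorem Route.elapsed_splice_add {k : ℕ} (hk : j + k ≤ Q.len) :
    (P.splice Q i j hij hdisj).elapsed ⟨i + k, by rw [len_splice]; omega⟩ + Q.elapsed j =
      P.elapsed i + Q.elapsed ⟨j + k, by omega⟩ := by
  induction k with
  | zero => exact congrArg (· + _) (elapsed_splice_of_le hij hdisj le_rfl)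
  | succ k ih =>
    have hsplice := (P.splice Q i j hij hdisj).elapsed_succ ⟨i + k, by rw [len_splice]; omega⟩
    have hQ := Q.elapsed_succ ⟨j + k, by omega⟩
    have hedge : (P.splice Q i j hij hdisj).edge ⟨i + k, by rw [len_splice]; omega⟩ =
      Q.edge ⟨j + k, by omega⟩ := by simp [splice]
    have := ih (by omega)
    simp only [Fin.succ_mk, Fin.castSucc_mk, hedge] at hsplice hQ
    simp only [← add_assoc]
    omega

theorem Route.transit_splice_add_elapsed :
    (P.splice Q i j hij hdisj).transit + Q.elapsed j = P.elapsed i + Q.transit := by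
  have hlast : (⟨j + (Q.len - j), by omega⟩ : Fin (Q.len + 1)) = Fin.last Q.len :=
    Fin.ext (Nat.add_sub_of_le j.is_le)
  rw [← elapsed_last, ← Q.elapsed_last, ← hlast]
  exact elapsed_splice_add hij hdisj (Nat.add_sub_of_le j.is_le).le

theorem Route.uses_of_uses_splice {r : V ⊕ E} {t : ℕ}
    (h : (P.splice Q i j hij hdisj).Uses r t) : (∃ t, P.Uses r t) ∨ ∃ t, Q.Uses r t := by
  rcases r with v | e
  all_goals
    obtain ⟨⟨k, hlen⟩, rfl, -⟩ := h
    rw [len_splice] at hlen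
    by_cases hk : k < i
  · exact .inl ⟨_, ⟨k, by omega⟩, by simp [splice, hk], rfl⟩
  · exact .inr ⟨_, ⟨j + (k - i), by omega⟩, by simp [splice, hk], rfl⟩
  · exact .inl ⟨_, ⟨k, by omega⟩, by simp [splice, hk], rfl⟩
  · exact .inr ⟨_, ⟨j + (k - i), by omega⟩, by simp [splice, hk], rfl⟩

end Splice

theorem Route.elapsed_mono (P : N.Route) : Monotone P.elapsed :=
  Fin.monotone_iff_le_succ.2 fun i => (P.elapsed_succ i).symm ▸ Nat.le_add_right _ _

theorem Route.exists_splice (P Q : N.Route) {i : Fin (P.len + 1)} {j : Fin (Q.len + 1)}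
    (hij : P.node i = Q.node j) :
    ∃ W : N.Route, (∀ r t, W.Uses r t → (∃ t, P.Uses r t) ∨ ∃ t, Q.Uses r t) ∧
      W.transit + Q.elapsed j ≤ P.elapsed i + Q.transit := by
  -- Leaving `P` at the first node from which `Q` can be joined at `j` or later gives a simple path.
  obtain ⟨i₀, ⟨j₀, hj₀, hij₀⟩, hmin⟩ := exists_minimal_of_wellFoundedLT
    (fun i => ∃ j₀ ≥ j, P.node i = Q.node j₀) ⟨i, j, le_rfl, hij⟩
  have hi₀ : i₀ ≤ i := not_lt.1 fun hlt => hlt.not_ge (hmin ⟨j, le_rfl, hij⟩ hlt.le)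
  have hdisj : ∀ i' < i₀, ∀ j' ≥ j₀, P.node i' ≠ Q.node j' := fun i' hi' j' hj' heq =>
    hi'.not_ge (hmin ⟨j', hj₀.trans hj', heq⟩ hi'.le)
  refine ⟨P.splice Q i₀ j₀ hij₀ hdisj, fun r t => uses_of_uses_splice hij₀ hdisj, ?_⟩
  have := transit_splice_add_elapsed hij₀ hdisj
  have := P.elapsed_mono hi₀
  have := Q.elapsed_mono hj₀
  omega

/-! ### Shortest paths -/

theorem exists_isShortest (rank : N.Route → ℕ) {R : N.RouteList}
    (h : ∃ P : N.Route, 0 < routeCap R P) : ∃ P, IsShortest rank R P := by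
  obtain ⟨P, hP, hmin⟩ := exists_minimalFor_of_wellFoundedLT _ (routeKey rank) h
  exact ⟨P, hP, fun Q hQ => not_lt.1 fun hlt => hlt.not_ge (hmin hQ hlt.le)⟩

section IsShortest

variable {R : N.RouteList} {P Q : N.Route} (hP : IsShortest rank R P) (hQ : 0 < routeCap R Q)
include hP hQ

theorem IsShortest.transit_le : P.transit ≤ Q.transit :=
  (Prod.Lex.le_iff.1 (hP.2 Q hQ)).elim le_of_lt fun h => h.1.le

/-- Otherwise one of the two paths obtained by switching between `P` and `Q` would beat `P`. -/
theorem IsShortest.elapsed_le_of_node_eq {i : Fin (P.len + 1)} {j : Fin (Q.len + 1)}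
    (hij : P.node i = Q.node j) :
    P.elapsed i ≤ Q.elapsed j ∧ P.transit + Q.elapsed j ≤ Q.transit + P.elapsed i := by
  have transit_le {W : N.Route}
      (hW : ∀ r t, W.Uses r t → (∃ t, P.Uses r t) ∨ ∃ t, Q.Uses r t) : P.transit ≤ W.transit := by
    refine hP.transit_le (routeCap_pos_iff.2 fun r t hr => ?_)
    rcases hW r t hr with ⟨t, ht⟩ | ⟨t, ht⟩
    · exact routeCap_pos_iff.1 hP.1 r t ht
    · exact routeCap_pos_iff.1 hQ r t ht
  obtain ⟨W, hW, hle⟩ := P.exists_splice Q hij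
  obtain ⟨W', hW', hle'⟩ := Q.exists_splice P hij.symm
  have := transit_le hW
  have := transit_le fun r t hr => (hW' r t hr).symm
  omega

theorem IsShortest.elapsed_le_of_edge_eq {i : Fin P.len} {j : Fin Q.len}
    (hij : P.edge i = Q.edge j) :
    P.elapsed i.castSucc ≤ Q.elapsed j.castSucc ∧
      P.transit + Q.elapsed j.castSucc ≤ Q.transit + P.elapsed i.castSucc := by
  rcases (P.joins i).eq_or_swap (hij ▸ Q.joins j) with ⟨h, -⟩ | ⟨h, h'⟩
  · exact hP.elapsed_le_of_node_eq hQ h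
  · have := hP.elapsed_le_of_node_eq hQ h
    have := hP.elapsed_le_of_node_eq hQ h'
    rw [Q.elapsed_succ] at *
    rw [P.elapsed_succ] at *
    omega

theorem IsShortest.le_of_uses {r : V ⊕ E} {t t' : ℕ} (ht : P.Uses r t) (ht' : Q.Uses r t') :
    t ≤ t' ∧ P.transit + t' ≤ Q.transit + t := by
  rcases r with v | e
  all_goals
    obtain ⟨i, hi, rfl⟩ := ht
    obtain ⟨j, hj, rfl⟩ := ht'
  · exact hP.elapsed_le_of_node_eq hQ (hi.trans hj.symm)
  · exact hP.elapsed_le_of_edge_eq hQ (hi.trans hj.symm)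

end IsShortest

/-! ### Greedy lists of shortest paths -/

/-- Each path of `G` is the shortest one in the network that remains after the previous paths, and
carries its capacity in that network: successive shortest paths without the stopping rules of
SSEP. -/
def IsGreedy (rank : N.Route → ℕ) (G : N.RouteList) : Prop :=
  ∀ i : Fin G.length, IsShortest rank (G.take i) (G.get i).1 ∧
    (G.get i).2 = routeCap (G.take i) (G.get i).1

theorem capacityLeft_le_of_sublist {R R' : N.RouteList} (h : R.Sublist R') (r : V ⊕ E) :
    capacityLeft R' r ≤ capacityLeft R r := by
  classical
  rw [capacityLeft_eq, capacityLeft_eq]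
  exact Nat.sub_le_sub_left ((h.map _).sum_le_sum fun _ _ => Nat.zero_le _) _

theorem routeCap_pos_of_sublist {R R' : N.RouteList} (h : R.Sublist R') {P : N.Route}
    (hP : 0 < routeCap R' P) : 0 < routeCap R P :=
  routeCap_pos_iff.2 fun r t hr =>
    (routeCap_pos_iff.1 hP r t hr).trans_le (capacityLeft_le_of_sublist h r)

theorem capacityLeft_source_snoc_lt {R : N.RouteList} {P : N.Route} (hP : 0 < routeCap R P) :
    capacityLeft (R ++ [(P, routeCap R P)]) (.inl N.source) < capacityLeft R (.inl N.source) := by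
  classical
  have hpos := routeCap_pos_iff.1 hP _ _ P.uses_source
  have huses : ∃ t, P.Uses (.inl N.source) t := ⟨_, P.uses_source⟩
  rw [capacityLeft_eq] at hpos ⊢
  rw [capacityLeft_eq, List.map_append, List.sum_append, List.map_singleton, List.sum_singleton,
    if_pos huses]
  omega

open Classical in
theorem capacityLeft_take_eq (G : N.RouteList) (n : ℕ) (r : V ⊕ E) :
    capacityLeft (G.take n) r = N.capacity r -
      ∑ l : Fin G.length with l.val < n ∧ ∃ t, (G.get l).1.Uses r t, (G.get l).2 := by
  rw [capacityLeft_eq, List.map_take, ← List.ofFn_getElem_eq_map, List.sum_take_ofFn]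
  rw [← Finset.filter_filter, Finset.sum_filter (fun l => ∃ t, _)]
  rfl

theorem isGreedy_nil (rank : N.Route → ℕ) : IsGreedy rank ([] : N.RouteList) :=
  fun i => i.elim0

namespace IsGreedy

variable {G : N.RouteList}

theorem snoc (hG : IsGreedy rank G) {P : N.Route} (hP : IsShortest rank G P) :
    IsGreedy rank (G ++ [(P, routeCap G P)]) := by
  rintro ⟨i, hi⟩
  rw [List.length_append, List.length_singleton] at hi
  rcases (Nat.lt_succ_iff.1 hi).lt_or_eq with h | rfl
  · have := hG ⟨i, h⟩
    simpa [List.take_append_of_le_length h.le, List.getElem_append_left h] using this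
  · simpa using hP

theorem cap_pos (hG : IsGreedy rank G) (i : Fin G.length) : 0 < (G.get i).2 :=
  (hG i).2 ▸ (hG i).1.1

theorem routeCap_take_pos (hG : IsGreedy rank G) {i j : Fin G.length} (hij : i ≤ j) :
    0 < routeCap (G.take i) (G.get j).1 :=
  routeCap_pos_of_sublist (List.take_prefix_take_left hij).sublist (hG j).1.1

theorem transit_mono (hG : IsGreedy rank G) {i j : Fin G.length} (hij : i ≤ j) :
    (G.get i).1.transit ≤ (G.get j).1.transit :=
  (hG i).1.transit_le (hG.routeCap_take_pos hij)

theorem exists_complete (hG : IsGreedy rank G) :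
    ∃ G', G <+: G' ∧ IsGreedy rank G' ∧ ¬ ∃ P : N.Route, 0 < routeCap G' P := by
  obtain ⟨G', ⟨hpre, hG'⟩, hmin⟩ := exists_minimalFor_of_wellFoundedLT
    (fun G' => G <+: G' ∧ IsGreedy rank G') (capacityLeft · (.inl N.source))
    ⟨G, List.prefix_rfl, hG⟩
  refine ⟨G', hpre, hG', fun h => ?_⟩
  obtain ⟨P, hP⟩ := exists_isShortest rank h
  have hlt := capacityLeft_source_snoc_lt hP.1
  exact hlt.not_ge (hmin ⟨hpre.trans (List.prefix_append _ _), hG'.snoc hP⟩ hlt.le)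

end IsGreedy

/-! ### The course of CCRP -/

/-- A slot of `G` consists of a departure time and a path of `G`. Slots are ordered by arrival time
at the sink and then by position of the path in `G`. -/
def slotKey (G : N.RouteList) (a : ℕ × Fin G.length) : ℕ ×ₗ Fin G.length :=
  toLex (a.1 + (G.get a.2).1.transit, a.2)

/-- The slots of `G` that precede the slot `b`. -/
def slotsBefore (G : N.RouteList) (b : ℕ × Fin G.length) : Finset (ℕ × Fin G.length) :=
  {a ∈ Finset.range (b.1 + (G.get b.2).1.transit + 1) ×ˢ Finset.univ | slotKey G a < slotKey G b}

/-- The undelayed group that fills the path of the slot `a` to capacity. -/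
def slotGroup (G : N.RouteList) (a : ℕ × Fin G.length) : N.Trip × ℕ :=
  ((G.get a.2).1.direct a.1, (G.get a.2).2)

/-- The groups of the plan `L` are, up to order, those of the slots before `b`. -/
def FillsSlotsBefore (G : N.RouteList) (L : N.Plan) (b : ℕ × Fin G.length) : Prop :=
  (L : Multiset (N.Trip × ℕ)) = (slotsBefore G b).val.map (slotGroup G)

variable {G : N.RouteList} {L : N.Plan} {a b : ℕ × Fin G.length} {r : V ⊕ E} {θ p : ℕ}

theorem slotKey_lt_slotKey :
    slotKey G a < slotKey G b ↔
      a.1 + (G.get a.2).1.transit < b.1 + (G.get b.2).1.transit ∨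
        a.1 + (G.get a.2).1.transit = b.1 + (G.get b.2).1.transit ∧ a.2 < b.2 :=
  Prod.Lex.toLex_lt_toLex

theorem slotKey_injective (G : N.RouteList) : Function.Injective (slotKey G) := by
  rintro ⟨δ, l⟩ ⟨δ', l'⟩ h
  obtain ⟨h, rfl⟩ : δ + _ = δ' + _ ∧ l = l' := Prod.mk.inj (toLex.injective h)
  rw [Nat.add_right_cancel h]

theorem mem_slotsBefore : a ∈ slotsBefore G b ↔ slotKey G a < slotKey G b := by
  simp only [slotsBefore, Finset.mem_filter, Finset.mem_product, Finset.mem_range, Finset.mem_univ,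
    and_true, and_iff_right_iff_imp, slotKey_lt_slotKey]
  omega

theorem notMem_slotsBefore_self : b ∉ slotsBefore G b :=
  fun h => lt_irrefl _ (mem_slotsBefore.1 h)

theorem IsGreedy.slotsBefore_zero (hG : IsGreedy rank G) (hne : 0 < G.length) :
    slotsBefore G (0, ⟨0, hne⟩) = ∅ := by
  refine Finset.eq_empty_of_forall_notMem fun a ha => ?_
  rw [mem_slotsBefore, slotKey_lt_slotKey] at ha
  have := hG.transit_mono (i := ⟨0, hne⟩) (j := a.2) (Nat.zero_le _)
  simp only [Fin.lt_def] at ha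
  omega

theorem exists_slotsBefore_eq_insert (b : ℕ × Fin G.length) :
    ∃ b', slotsBefore G b' = insert b (slotsBefore G b) := by
  obtain ⟨b', hbb', hmin⟩ := exists_minimalFor_of_wellFoundedLT (slotKey G b < slotKey G ·)
    (slotKey G) ⟨(b.1 + 1, b.2), slotKey_lt_slotKey.2 (.inl (by dsimp only; omega))⟩
  refine ⟨b', Finset.ext fun a => ?_⟩
  rw [Finset.mem_insert, mem_slotsBefore, mem_slotsBefore, ← (slotKey_injective G).eq_iff,
    ← le_iff_eq_or_lt]
  exact ⟨fun h => not_lt.1 fun hba => h.not_ge (hmin hba h.le), fun h => h.trans_lt hbb'⟩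

theorem arrival_slotGroup (a : ℕ × Fin G.length) :
    (slotGroup G a).1.arrival = a.1 + (G.get a.2).1.transit :=
  Route.arrival_direct _ _

theorem eq_of_occupies_slotGroup (h : a.2 = b.2) (ha : (slotGroup G a).1.Occupies r θ)
    (hb : (slotGroup G b).1.Occupies r θ) : a = b := by
  obtain ⟨δ, l⟩ := a
  obtain ⟨δ', l'⟩ := b
  obtain rfl : l = l' := h
  obtain ⟨t, ht, rfl⟩ := Route.occupies_direct_iff.1 ha
  obtain ⟨t', ht', hθ⟩ := Route.occupies_direct_iff.1 hb
  obtain rfl := ht.unique ht'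
  exact congrArg (·, l) (Nat.add_right_cancel hθ)

theorem IsGreedy.snd_lt_snd_of_slotKey_lt (hG : IsGreedy rank G) (hab : slotKey G a < slotKey G b)
    (ha : (slotGroup G a).1.Occupies r θ) (hb : (slotGroup G b).1.Occupies r θ) : a.2 < b.2 := by
  by_contra! hle
  obtain ⟨t, ht, rfl⟩ := Route.occupies_direct_iff.1 ha
  obtain ⟨t', ht', hθ⟩ := Route.occupies_direct_iff.1 hb
  have := (hG b.2).1.le_of_uses (hG.routeCap_take_pos hle) ht' ht
  rw [slotKey_lt_slotKey] at hab
  omega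

theorem IsShortest.exists_occupies_direct {R : N.RouteList} {P : N.Route}
    (hP : IsShortest rank R P) {y : N.Trip} (hy : 0 < routeCap R y.route) (hr : y.Occupies r θ)
    {t : ℕ} (ht : P.Uses r t) :
    ∃ δ, (P.direct δ).Occupies r θ ∧ δ + P.transit ≤ y.arrival := by
  obtain ⟨t', ht', _, _⟩ := hr.exists_uses
  have := hP.le_of_uses hy ht ht'
  exact ⟨θ - t, Route.occupies_direct_iff.2 ⟨t, ht, by omega⟩, by omega⟩

theorem routeCap_nil_pos_of_tripCap_pos {y : N.Trip} (hy : 0 < tripCap L y) :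
    0 < routeCap [] y.route := by
  refine routeCap_pos_iff.2 fun r t hr => ?_
  obtain ⟨θ, ho⟩ := Trip.exists_occupies hr
  refine (capacityFree_pos_of_occupies hy ho).trans_le ?_
  simp [capacityFree_eq, capacityLeft_eq]

namespace FillsSlotsBefore

theorem sum_map_eq {M : Type*} [AddCommMonoid M] (h : FillsSlotsBefore G L b)
    (f : N.Trip × ℕ → M) : (L.map f).sum = ∑ a ∈ slotsBefore G b, f (slotGroup G a) := by
  have := congrArg (fun s => (s.map f).sum) h
  simpa using this

open Classical in
theorem capacityFree_eq (h : FillsSlotsBefore G L b) (r : V ⊕ E) (θ : ℕ) :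
    capacityFree L r θ = N.capacity r -
      ∑ a ∈ slotsBefore G b with (slotGroup G a).1.Occupies r θ, (G.get a.2).2 := by
  rw [EvacNetwork.capacityFree_eq, h.sum_map_eq, Finset.sum_filter]
  rfl

theorem capacityFree_le (h : FillsSlotsBefore G L b) (hG : IsGreedy rank G) {y : N.Trip} {n : ℕ}
    (hy : y.Occupies r θ)
    (hcap : ∀ l : Fin G.length, l.val < n → 0 < routeCap (G.take l) y.route)
    (hb : ∀ l : Fin G.length, l.val < n → toLex (y.arrival, l) < slotKey G b) :
    capacityFree L r θ ≤ capacityLeft (G.take n) r := by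
  classical
  rw [h.capacityFree_eq, capacityLeft_take_eq]
  refine Nat.sub_le_sub_left ?_ _
  have exists_slot (l : Fin G.length) (hl : l.val < n ∧ ∃ t, (G.get l).1.Uses r t) :
      ∃ δ, (δ, l) ∈ slotsBefore G b ∧ (slotGroup G (δ, l)).1.Occupies r θ := by
    obtain ⟨hln, t, ht⟩ := hl
    obtain ⟨δ, hδ, hle⟩ := (hG l).1.exists_occupies_direct (hcap l hln) hy ht
    refine ⟨δ, mem_slotsBefore.2 (lt_of_le_of_lt ?_ (hb l hln)), hδ⟩
    exact Prod.Lex.toLex_mono ⟨hle, le_rfl⟩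
  choose! δ hδ using exists_slot
  rw [← Finset.sum_image (s := {l | _}) (g := fun l => (δ l, l)) (f := fun a => (G.get a.2).2)
    fun l _ l' _ h => congrArg Prod.snd h]
  refine Finset.sum_le_sum_of_subset fun a ha => ?_
  obtain ⟨l, hl, rfl⟩ := Finset.mem_image.1 ha
  exact Finset.mem_filter.2 (hδ l (Finset.mem_filter.1 hl).2)

theorem le_capacityFree (h : FillsSlotsBefore G L b) (hG : IsGreedy rank G)
    (hb : (slotGroup G b).1.Occupies r θ) : capacityLeft (G.take b.2) r ≤ capacityFree L r θ := by
  classical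
  rw [h.capacityFree_eq, capacityLeft_take_eq]
  refine Nat.sub_le_sub_left ?_ _
  rw [← Finset.sum_image (g := Prod.snd) (f := fun l => (G.get l).2) fun a ha a' ha' h =>
    eq_of_occupies_slotGroup h (Finset.mem_filter.1 ha).2 (Finset.mem_filter.1 ha').2]
  refine Finset.sum_le_sum_of_subset fun l hl => ?_
  obtain ⟨a, ha, rfl⟩ := Finset.mem_image.1 hl
  obtain ⟨hab, ha⟩ := Finset.mem_filter.1 ha
  obtain ⟨t, ht, -⟩ := Route.occupies_direct_iff.1 ha
  exact Finset.mem_filter.2 ⟨Finset.mem_univ _,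
    hG.snd_lt_snd_of_slotKey_lt (mem_slotsBefore.1 hab) ha hb, t, ht⟩

theorem capacityFree_eq_capacityLeft (h : FillsSlotsBefore G L b) (hG : IsGreedy rank G)
    (hb : (slotGroup G b).1.Occupies r θ) :
    capacityFree L r θ = capacityLeft (G.take b.2) r := by
  refine (h.capacityFree_le hG hb (fun l hl => hG.routeCap_take_pos (Fin.le_of_lt hl))
    fun l hl => ?_).antisymm (h.le_capacityFree hG hb)
  rw [arrival_slotGroup]
  exact Prod.Lex.toLex_lt_toLex.2 (.inr ⟨rfl, hl⟩)

theorem tripCap_slotGroup (h : FillsSlotsBefore G L b) (hG : IsGreedy rank G) :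
    tripCap L (slotGroup G b).1 = (slotGroup G b).2 := by
  rw [tripCap_eq_sInf, slotGroup, (hG b.2).2, routeCap_eq_sInf]
  congr 1
  ext c
  constructor
  · rintro ⟨r, θ, ho, rfl⟩
    obtain ⟨t, ht, -⟩ := Route.occupies_direct_iff.1 ho
    exact ⟨r, t, ht, h.capacityFree_eq_capacityLeft hG ho⟩
  · rintro ⟨r, t, ht, rfl⟩
    have ho := Route.occupies_direct_iff (δ := b.1).2 ⟨t, ht, rfl⟩
    exact ⟨r, _, ho, (h.capacityFree_eq_capacityLeft hG ho).symm⟩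

theorem routeCap_take_pos (h : FillsSlotsBefore G L b) (hG : IsGreedy rank G) {y : N.Trip}
    (hy : 0 < tripCap L y) {n : ℕ}
    (hb : ∀ l : Fin G.length, l.val < n → toLex (y.arrival, l) < slotKey G b) :
    0 < routeCap (G.take n) y.route := by
  induction n with
  | zero => exact routeCap_nil_pos_of_tripCap_pos hy
  | succ n ih =>
    have ih := ih fun l hl => hb l (by omega)
    refine routeCap_pos_iff.2 fun r t hr => ?_
    obtain ⟨θ, ho⟩ := Trip.exists_occupies hr
    refine (capacityFree_pos_of_occupies hy ho).trans_le (h.capacityFree_le hG ho ?_ hb)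
    exact fun l hl => routeCap_pos_of_sublist
      (List.take_prefix_take_left (Nat.lt_succ_iff.1 hl)).sublist ih

theorem tripKey_slotGroup_le (h : FillsSlotsBefore G L b) (hG : IsGreedy rank G)
    (hc : ¬ ∃ P : N.Route, 0 < routeCap G P) {y : N.Trip} (hy : 0 < tripCap L y) :
    tripKey rank (slotGroup G b).1 ≤ tripKey rank y := by
  simp only [tripKey, Prod.Lex.toLex_le_toLex, arrival_slotGroup]
  rcases lt_trichotomy y.arrival (b.1 + (G.get b.2).1.transit) with hlt | heq | hgt
  · refine absurd ⟨y.route, ?_⟩ hc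
    simpa using h.routeCap_take_pos hG hy (n := G.length)
      fun l _ => Prod.Lex.toLex_lt_toLex.2 (.inl hlt)
  · refine .inr ⟨heq.symm, ?_⟩
    have hcap := h.routeCap_take_pos hG hy (n := b.2)
      fun l hl => Prod.Lex.toLex_lt_toLex.2 (.inr ⟨heq, hl⟩)
    rcases ((hG b.2).1.2 _ hcap).lt_or_eq with hk | hk
    · exact .inl hk
    · refine .inr ⟨hk, ?_⟩
      have := y.start_add_transit_le_arrival
      have : (G.get b.2).1.transit = y.route.transit := congrArg (fun k => (ofLex k).1) hk
      rw [slotGroup, Route.start_direct]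
      omega
  · exact .inl hgt

theorem isCCRPChoice_iff (h : FillsSlotsBefore G L b) (hG : IsGreedy rank G)
    (hc : ¬ ∃ P : N.Route, 0 < routeCap G P) (hrank : Function.Injective rank) {x : N.Trip} :
    IsCCRPChoice rank L x ↔ x = (slotGroup G b).1 := by
  have hpos : 0 < tripCap L (slotGroup G b).1 := h.tripCap_slotGroup hG ▸ hG.cap_pos b.2
  constructor
  · exact fun hx => Trip.eq_direct_of_tripKey_eq hrank
      ((hx.2 _ hpos).antisymm (h.tripKey_slotGroup_le hG hc hx.1))
  · rintro rfl
    exact ⟨hpos, fun y => h.tripKey_slotGroup_le hG hc⟩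

theorem exists_snoc (h : FillsSlotsBefore G L b) :
    ∃ b', FillsSlotsBefore G (L ++ [slotGroup G b]) b' := by
  obtain ⟨b', hb'⟩ := exists_slotsBefore_eq_insert b
  refine ⟨b', ?_⟩
  rw [FillsSlotsBefore, hb', Finset.insert_val_of_notMem notMem_slotsBefore_self,
    Multiset.map_cons, ← h, Multiset.cons_coe]
  exact Multiset.coe_eq_coe.2 List.perm_append_comm

end FillsSlotsBefore

theorem IsGreedy.fillsSlotsBefore_nil (hG : IsGreedy rank G) (hne : 0 < G.length) :
    FillsSlotsBefore G [] (0, ⟨0, hne⟩) := by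
  rw [FillsSlotsBefore, hG.slotsBefore_zero]
  rfl

theorem Plan.people_snoc (L : N.Plan) (x : N.Trip) (c : ℕ) :
    Plan.people (L ++ [(x, c)]) = L.people + c := by
  simp [Plan.people]

theorem CCRPReaches.exists_fillsSlotsBefore (hL : CCRPReaches rank p L) (hp : L.people < p)
    (hrank : Function.Injective rank) (hG : IsGreedy rank G) (hne : G ≠ [])
    (hc : ¬ ∃ P : N.Route, 0 < routeCap G P) : ∃ b, FillsSlotsBefore G L b := by
  induction hL with
  | init => exact ⟨_, hG.fillsSlotsBefore_nil (List.length_pos_of_ne_nil hne)⟩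
  | reserve L x _ hp' hx ih =>
    obtain ⟨b, hb⟩ := ih hp'
    obtain rfl := (hb.isCCRPChoice_iff hG hc hrank).1 hx
    rw [Plan.people_snoc] at hp
    rw [min_eq_right (by omega), hb.tripCap_slotGroup hG]
    exact hb.exists_snoc

theorem exists_isCCRPSolution (hrank : Function.Injective rank)
    (hreach : ∃ P : N.Route, 0 < routeCap [] P) (p : ℕ) :
    ∃ L : N.Plan, IsCCRPSolution rank p L := by
  obtain ⟨G, -, hG, hc⟩ := (isGreedy_nil rank).exists_complete
  have hne : G ≠ [] := by
    rintro rfl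
    exact hc hreach
  suffices ∀ n, ∃ L : N.Plan, CCRPReaches rank p L ∧ L.people ≤ p ∧ min n p ≤ L.people by
    obtain ⟨L, hL, hle, hge⟩ := this p
    exact ⟨L, hL, hle.antisymm (by simpa using hge)⟩
  intro n
  induction n with
  | zero => exact ⟨[], .init, Nat.zero_le _, by simp⟩
  | succ n ih =>
    obtain ⟨L, hL, hle, hge⟩ := ih
    rcases hle.eq_or_lt with heq | hlt
    · exact ⟨L, hL, hle, by omega⟩
    obtain ⟨b, hb⟩ := hL.exists_fillsSlotsBefore hlt hrank hG hne hc
    have hx := (hb.isCCRPChoice_iff hG hc hrank).2 rfl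
    have := hx.1
    refine ⟨_, .reserve L _ hL hlt hx, ?_⟩
    rw [Plan.people_snoc]
    omega

theorem Plan.evacTime_le_iff {z : ℕ} : L.evacTime ≤ z ↔ ∀ q ∈ L, q.1.arrival ≤ z := by
  induction L with
  | nil => simp [Plan.evacTime]
  | cons q L ih =>
    rw [List.forall_mem_cons, ← ih]
    simp [Plan.evacTime]

theorem Plan.arrival_le_evacTime {q : N.Trip × ℕ} (hq : q ∈ L) : q.1.arrival ≤ L.evacTime :=
  Plan.evacTime_le_iff.1 le_rfl q hq

/-! ### Throughput -/

/-- The number of people that the paths of `R`, with their capacities at discovery, can take to the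
sink by time `z`. By truncation of the subtraction, a path too slow to arrive in time contributes
nothing. -/
def throughput (R : N.RouteList) (z : ℕ) : ℕ :=
  (R.map fun q => q.2 * (z + 1 - q.1.transit)).sum

theorem throughput_append (R R' : N.RouteList) (z : ℕ) :
    throughput (R ++ R') z = throughput R z + throughput R' z := by
  simp [throughput]

theorem throughput_eq_sum (R : N.RouteList) (z : ℕ) :
    throughput R z = ∑ i : Fin R.length, (R.get i).2 * (z + 1 - (R.get i).1.transit) :=
  (Fin.sum_univ_fun_getElem R fun q => q.2 * (z + 1 - q.1.transit)).symm

theorem throughput_mono (R : N.RouteList) : Monotone (throughput R) := fun z z' hz =>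
  List.sum_le_sum fun q _ => Nat.mul_le_mul_left _ (by omega)

theorem throughput_eq_zero {R : N.RouteList} {z : ℕ} (hz : ∀ q ∈ R, z < q.1.transit) :
    throughput R z = 0 := by
  refine List.sum_eq_zero fun c hc => ?_
  obtain ⟨q, hq, rfl⟩ := List.mem_map.1 hc
  rw [Nat.sub_eq_zero_of_le (hz q hq), mul_zero]

theorem length_le_throughput {R : N.RouteList} {z : ℕ} (hpos : ∀ q ∈ R, 0 < q.2)
    (hz : ∀ q ∈ R, q.1.transit ≤ z) : R.length ≤ throughput R z := by
  rw [← List.length_map (as := R), throughput]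
  refine List.length_le_sum_of_one_le _ fun c hc => ?_
  obtain ⟨q, hq, rfl⟩ := List.mem_map.1 hc
  exact Nat.mul_pos (hpos q hq) (Nat.sub_pos_of_lt (Nat.lt_succ_of_le (hz q hq)))

theorem natCast_throughput {R : N.RouteList} {z : ℕ} (hz : ∀ q ∈ R, q.1.transit ≤ z + 1) :
    (throughput R z : ℤ) = (R.map fun q => (q.2 : ℤ) * (z + 1 - q.1.transit)).sum := by
  rw [throughput, Nat.cast_list_sum, List.map_map]
  refine congrArg List.sum (List.map_congr_left fun q hq => ?_)
  simp [Nat.cast_sub (hz q hq)]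

theorem sum_slots_eq_throughput (G : N.RouteList) (z : ℕ) :
    ∑ a ∈ Finset.range (z + 1) ×ˢ Finset.univ with a.1 + (G.get a.2).1.transit ≤ z,
      (G.get a.2).2 = throughput G z := by
  rw [throughput_eq_sum, Finset.sum_filter, Finset.sum_product_right]
  refine Finset.sum_congr rfl fun l _ => ?_
  have hdep : {δ ∈ Finset.range (z + 1) | δ + (G.get l).1.transit ≤ z} =
      Finset.range (z + 1 - (G.get l).1.transit) := by
    ext δ
    simp only [Finset.mem_filter, Finset.mem_range]
    omega
  dsimp only
  rw [← Finset.sum_filter, hdep, Finset.sum_const, Finset.card_range, smul_eq_mul, mul_comm]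

theorem FillsSlotsBefore.people_add_le_throughput (h : FillsSlotsBefore G L b) :
    L.people + (slotGroup G b).2 ≤ throughput G (slotGroup G b).1.arrival := by
  rw [Plan.people, h.sum_map_eq, add_comm, arrival_slotGroup,
    ← Finset.sum_insert (f := fun a => (slotGroup G a).2) notMem_slotsBefore_self,
    ← sum_slots_eq_throughput]
  refine Finset.sum_le_sum_of_subset fun a ha => ?_
  rw [Finset.mem_insert, mem_slotsBefore, slotKey_lt_slotKey] at ha
  simp only [Finset.mem_filter, Finset.mem_product, Finset.mem_range, Finset.mem_univ, and_true]
  rcases ha with rfl | ha <;> omega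

theorem IsCCRPSolution.le_throughput (hL : IsCCRPSolution rank p L) (hp : 0 < p)
    (hrank : Function.Injective rank) (hG : IsGreedy rank G) (hne : G ≠ [])
    (hc : ¬ ∃ P : N.Route, 0 < routeCap G P) : p ≤ throughput G L.evacTime := by
  obtain ⟨hL, hpeople⟩ := hL
  cases hL with
  | init => exact absurd hpeople hp.ne
  | reserve L x hL hp' hx =>
    obtain ⟨b, hb⟩ := hL.exists_fillsSlotsBefore hp' hrank hG hne hc
    obtain rfl := (hb.isCCRPChoice_iff hG hc hrank).1 hx
    have harrival := Plan.arrival_le_evacTime (List.mem_append_right L (List.mem_singleton_self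
      ((slotGroup G b).1, min (p - L.people) (tripCap L (slotGroup G b).1))))
    calc p = L.people + min (p - L.people) (tripCap L (slotGroup G b).1) := by
          rw [← Plan.people_snoc, hpeople]
      _ ≤ L.people + (slotGroup G b).2 := by
          rw [hb.tripCap_slotGroup hG]
          exact Nat.add_le_add_left (min_le_right _ _) _
      _ ≤ throughput G (slotGroup G b).1.arrival := hb.people_add_le_throughput
      _ ≤ _ := throughput_mono G harrival

/-! ### The combined evacuation time -/

section cet

variable {R : N.RouteList} (hne : R ≠ []) (hpos : ∀ q ∈ R, 0 < q.2)
include hne hpos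

theorem cet_le_iff_le_sum {z : ℤ} :
    cet p R ≤ z ↔ (p : ℤ) ≤ (R.map fun q => (q.2 : ℤ) * (z + 1 - q.1.transit)).sum := by
  have hsum : 0 < (R.map fun q => (q.2 : ℚ)).sum := by
    refine List.sum_pos _ ?_ (by simpa using hne)
    intro c hc
    obtain ⟨q, hq, rfl⟩ := List.mem_map.1 hc
    exact_mod_cast hpos q hq
  have hcast : (((R.map fun q => (q.2 : ℤ) * (z + 1 - q.1.transit)).sum : ℤ) : ℚ) =
      (z + 1) * (R.map fun q => (q.2 : ℚ)).sum -
        (R.map fun q => (q.2 : ℚ) * q.1.transit).sum := by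
    clear hsum hne hpos
    induction R with
    | nil => simp
    | cons q R ih =>
      simp only [List.map_cons, List.sum_cons, Int.cast_add, ih]
      push_cast
      ring
  rw [cet, sub_le_iff_le_add, Int.ceil_le, div_le_iff₀ hsum, ← Int.cast_le (R := ℚ), hcast,
    le_sub_iff_add_le]
  push_cast
  rfl

theorem cet_le_iff_le_throughput (hT : ∀ q ∈ R, (q.1.transit : ℤ) ≤ cet p R) {z : ℕ} :
    cet p R ≤ z ↔ p ≤ throughput R z := by
  constructor <;> intro h
  · have hz : ∀ q ∈ R, q.1.transit ≤ z + 1 := fun q hq => by have := hT q hq; omega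
    rw [cet_le_iff_le_sum hne hpos, ← natCast_throughput hz] at h
    exact_mod_cast h
  · by_contra! hlt
    obtain ⟨w, hw⟩ : ∃ w : ℕ, cet p R = w + 1 := ⟨(cet p R - 1).toNat, by omega⟩
    have hle : cet p R ≤ w := by
      have hw' : ∀ q ∈ R, q.1.transit ≤ w + 1 := fun q hq => by have := hT q hq; omega
      rw [cet_le_iff_le_sum hne hpos, ← natCast_throughput hw']
      exact_mod_cast h.trans (throughput_mono R (by omega))
    omega

end cet

theorem transit_le_cet_snoc (hp : 0 < p) {R : N.RouteList} {P : N.Route} {c : ℕ}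
    (hpos : ∀ q ∈ R ++ [(P, c)], 0 < q.2) (hP : R = [] ∨ (P.transit : ℤ) ≤ cet p R) :
    (P.transit : ℤ) ≤ cet p (R ++ [(P, c)]) := by
  -- At time `P.transit - 1` the path `P` contributes nothing to the sum that determines `cet`.
  by_contra! hlt
  have hle := (cet_le_iff_le_sum (by simp) hpos).1 (Int.le_sub_one_of_lt hlt)
  simp only [List.map_append, List.sum_append, List.map_singleton, List.sum_singleton,
    sub_add_cancel, sub_self, mul_zero, add_zero] at hle
  rcases eq_or_ne R [] with rfl | hne
  · simp only [List.map_nil, List.sum_nil] at hle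
    omega
  · have := (cet_le_iff_le_sum (z := P.transit - 1) hne
      fun q hq => hpos q (List.mem_append_left _ hq)).2 (by simpa using hle)
    have := hP.resolve_left hne
    omega

/-! ### Solutions of SSEP -/

theorem IsGreedy.cap_pos_of_mem (hG : IsGreedy rank G) {q : N.Route × ℕ} (hq : q ∈ G) :
    0 < q.2 := by
  obtain ⟨i, rfl⟩ := List.get_of_mem hq
  exact hG.cap_pos i

theorem IsGreedy.routeCap_pos_of_mem {R R' : N.RouteList} (hG : IsGreedy rank (R ++ R'))
    {q : N.Route × ℕ} (hq : q ∈ R') : 0 < routeCap R q.1 := by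
  obtain ⟨i, hi, rfl⟩ := List.mem_iff_getElem.1 hq
  have hpos := (hG ⟨R.length + i, by simpa using hi⟩).1.1
  simp only [List.get_eq_getElem, List.getElem_append_right (Nat.le_add_right _ _),
    Nat.add_sub_cancel_left] at hpos
  exact routeCap_pos_of_sublist (List.take_length_add_append i ▸ List.sublist_append_left _ _) hpos

theorem IsGreedy.transit_le (hG : IsGreedy rank G) {P : N.Route} (hP : 0 < routeCap G P)
    {q : N.Route × ℕ} (hq : q ∈ G) : q.1.transit ≤ P.transit := by
  obtain ⟨i, rfl⟩ := List.get_of_mem hq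
  exact (hG i).1.transit_le (routeCap_pos_of_sublist (List.take_sublist _ _) hP)

section SSEP

variable {R : N.RouteList}

theorem SSEPReaches.isGreedy (hR : SSEPReaches rank p R) : IsGreedy rank R := by
  induction hR with
  | init => exact isGreedy_nil rank
  | add _ _ _ _ hP _ ih => exact ih.snoc hP

theorem SSEPReaches.transit_le_cet (hR : SSEPReaches rank p R) (hp : 0 < p)
    {q : N.Route × ℕ} (hq : q ∈ R) : (q.1.transit : ℤ) ≤ cet p R := by
  have hG := hR.isGreedy
  cases hR with
  | init => simp at hq
  | add R P hR _ hP hT =>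
    refine le_trans (Nat.cast_le.2 ?_) (transit_le_cet_snoc hp (fun q => hG.cap_pos_of_mem) hT)
    rcases List.mem_append.1 hq with hq | hq
    · exact hR.isGreedy.transit_le hP.1 hq
    · rw [List.mem_singleton.1 hq]

theorem SSEPReaches.cet_le_iff (hR : SSEPReaches rank p R) (hp : 0 < p) (hne : R ≠ []) {z : ℕ} :
    cet p R ≤ z ↔ p ≤ throughput R z :=
  cet_le_iff_le_throughput hne (fun _ => hR.isGreedy.cap_pos_of_mem) fun _ => hR.transit_le_cet hp

theorem SSEPReaches.exists_natCast_eq_cet (hR : SSEPReaches rank p R) (hp : 0 < p)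
    (hne : R ≠ []) : ∃ z : ℕ, (z : ℤ) = cet p R :=
  CanLift.prf _ ((Int.natCast_nonneg _).trans (hR.transit_le_cet hp (List.head_mem hne)))

theorem SSEPStops.ne_nil (h : SSEPStops rank p R) (hp : 0 < p)
    (hreach : ∃ P : N.Route, 0 < routeCap [] P) : R ≠ [] := by
  rintro rfl
  rcases h with h | h | ⟨P, -, h, -⟩
  · exact hp.not_ge h
  · exact h hreach
  · exact h rfl

theorem SSEPStops.cet_le_transit (hs : SSEPStops rank p R) (hR : SSEPReaches rank p R) (hp : 0 < p)
    (hne : R ≠ []) {P : N.Route} (hP : 0 < routeCap R P) : cet p R ≤ P.transit := by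
  rcases hs with hlen | hc | ⟨P', hP', -, hlt⟩
  · exact (hR.cet_le_iff hp hne).2 (hlen.trans (length_le_throughput
      (fun _ => hR.isGreedy.cap_pos_of_mem) fun _ => hR.isGreedy.transit_le hP))
  · exact absurd ⟨P, hP⟩ hc
  · exact hlt.le.trans (Nat.cast_le.2 (hP'.transit_le hP))

theorem exists_ssepReaches_ssepStops (N : EvacNetwork V E) (rank : N.Route → ℕ) (p : ℕ) :
    ∃ R, SSEPReaches rank p R ∧ SSEPStops rank p R := by
  suffices ∀ n, ∃ R, SSEPReaches rank p R ∧ (SSEPStops rank p R ∨ R.length = n) by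
    obtain ⟨R, hR, h⟩ := this p
    exact ⟨R, hR, h.elim id fun hlen => .inl hlen.ge⟩
  intro n
  induction n with
  | zero => exact ⟨[], .init, .inr rfl⟩
  | succ n ih =>
    obtain ⟨R, hR, hlen⟩ := ih
    by_cases hs : SSEPStops rank p R
    · exact ⟨R, hR, .inl hs⟩
    have hlen := hlen.resolve_left hs
    rw [SSEPStops, not_or, not_or, not_le, not_not] at hs
    obtain ⟨hlt, hex, hT⟩ := hs
    obtain ⟨P, hP⟩ := exists_isShortest rank hex
    have hT : R = [] ∨ (P.transit : ℤ) ≤ cet p R :=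
      or_iff_not_imp_left.2 fun hne => not_lt.1 fun hlt => hT ⟨P, hP, hne, hlt⟩
    exact ⟨_, hR.add R P hlt hP hT, .inr (by simpa using hlen)⟩

theorem numGroups_le_iff {x c n : ℕ} (hc : 0 < c) : numGroups x c ≤ n ↔ x ≤ c * n := by
  rw [numGroups, Nat.ceil_le, div_le_iff₀ (by exact_mod_cast hc), mul_comm c n]
  exact_mod_cast Iff.rfl

theorem evacTime_ssepPlan_le_iff {x : Fin R.length → ℕ} {z : ℕ} :
    (ssepPlan R x).evacTime ≤ z ↔
      ∀ i, numGroups (x i) (R.get i).2 ≤ z + 1 - (R.get i).1.transit := by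
  simp only [Plan.evacTime_le_iff, ssepPlan, List.forall_mem_flatMap, List.forall_mem_map,
    List.mem_finRange, List.mem_range, forall_const, Route.arrival_direct]
  refine forall_congr' fun i => ⟨fun h => ?_, fun h j hj => by omega⟩
  rcases Nat.eq_zero_or_pos (numGroups (x i) (R.get i).2) with hzero | hpos
  · omega
  · have := h (numGroups (x i) (R.get i).2 - 1) (by omega)
    omega

theorem exists_isSSEPSolution (rank : N.Route → ℕ) (hp : 0 < p)
    (hreach : ∃ P : N.Route, 0 < routeCap [] P) :
    ∃ (R : N.RouteList) (x : Fin R.length → ℕ), IsSSEPSolution rank p R x := by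
  obtain ⟨R, hR, hs⟩ := exists_ssepReaches_ssepStops N rank p
  have hne := hs.ne_nil hp hreach
  obtain ⟨z, hz⟩ := hR.exists_natCast_eq_cet hp hne
  have hle := (hR.cet_le_iff hp hne).1 hz.ge
  rw [throughput_eq_sum] at hle
  obtain ⟨x, hx, hsum⟩ := Finsupp.exists_le_degree_eq (f := Finsupp.equivFunOnFinite.symm
    fun i : Fin R.length => (R.get i).2 * (z + 1 - (R.get i).1.transit)) p
    (by simpa [Finsupp.degree_eq_sum] using hle)
  refine ⟨R, x, hR, hs, by simpa [Finsupp.degree_eq_sum] using hsum, fun i => ?_⟩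
  have := (numGroups_le_iff (hR.isGreedy.cap_pos i)).2 (hx i)
  have := hR.transit_le_cet hp (List.get_mem R i)
  omega

namespace IsSSEPSolution

variable {x : Fin R.length → ℕ} (h : IsSSEPSolution rank p R x)
include h

theorem le_throughput : p ≤ throughput R (ssepPlan R x).evacTime := by
  rw [← h.sum_eq, throughput_eq_sum]
  exact Finset.sum_le_sum fun i _ =>
    (numGroups_le_iff (h.reaches.isGreedy.cap_pos i)).1 (evacTime_ssepPlan_le_iff.1 le_rfl i)

theorem evacTime_eq_cet (hp : 0 < p) (hreach : ∃ P : N.Route, 0 < routeCap [] P) :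
    ((ssepPlan R x).evacTime : ℤ) = cet p R := by
  have hne := h.stops.ne_nil hp hreach
  obtain ⟨z, hz⟩ := h.reaches.exists_natCast_eq_cet hp hne
  refine le_antisymm ?_ ((h.reaches.cet_le_iff hp hne).2 h.le_throughput)
  rw [← hz, Nat.cast_le, evacTime_ssepPlan_le_iff]
  intro i
  have := h.time_le i
  omega

theorem cet_le_evacTime_ccrp (hp : 0 < p) (hreach : ∃ P : N.Route, 0 < routeCap [] P)
    (hrank : Function.Injective rank) (hL : IsCCRPSolution rank p L) : cet p R ≤ L.evacTime := by
  have hne := h.stops.ne_nil hp hreach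
  obtain ⟨_, ⟨R', rfl⟩, hG, hc⟩ := h.reaches.isGreedy.exists_complete
  have hle := hL.le_throughput hp hrank hG (by simp [hne]) hc
  by_contra! hlt
  have too_slow : ∀ q ∈ R', L.evacTime < q.1.transit := fun q hq => by
    exact_mod_cast hlt.trans_le
      (h.stops.cet_le_transit h.reaches hp hne (hG.routeCap_pos_of_mem hq))
  rw [throughput_append, throughput_eq_zero too_slow, add_zero] at hle
  exact hlt.not_ge ((h.reaches.cet_le_iff hp hne).2 hle)

end IsSSEPSolution

end SSEP

end EvacNetwork

theorem mainTheorem1_general {V E : Type*} (N : EvacNetwork V E)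
    (rank : N.Route → ℕ) (hrank : Function.Injective rank)
    (p : ℕ) (hp : 0 < p)
    (hreach : ∃ P : N.Route, (∀ i, 0 < N.nodeCap (P.node i)) ∧ ∀ i, 0 < N.edgeCap (P.edge i)) :
    (∃ (R : N.RouteList) (x : Fin R.length → ℕ), EvacNetwork.IsSSEPSolution rank p R x) ∧
    (∃ L : N.Plan, EvacNetwork.IsCCRPSolution rank p L) ∧
    ∀ (R : N.RouteList) (x : Fin R.length → ℕ) (L : N.Plan),
      EvacNetwork.IsSSEPSolution rank p R x → EvacNetwork.IsCCRPSolution rank p L →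
        ((EvacNetwork.ssepPlan R x).evacTime : ℤ) = EvacNetwork.cet p R ∧
        (EvacNetwork.ssepPlan R x).evacTime ≤ L.evacTime := by
  have hreach' : ∃ P : N.Route, 0 < EvacNetwork.routeCap [] P :=
    hreach.imp fun P hP => EvacNetwork.routeCap_nil_pos hP.1 hP.2
  refine ⟨EvacNetwork.exists_isSSEPSolution rank hp hreach',
    EvacNetwork.exists_isCCRPSolution hrank hreach' p, fun R x L hR hL => ?_⟩
  have hcet := hR.evacTime_eq_cet hp hreach'
  have hccrp := hR.cet_le_evacTime_ccrp hp hreach' hrank hL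
  exact ⟨hcet, by exact_mod_cast hcet.trans_le hccrp⟩

theorem mainTheorem1 {V E : Type*} [Finite V] [Finite E] (N : EvacNetwork V E)
    (rank : N.Route → ℕ) (hrank : Function.Injective rank)
    (p : ℕ) (hp : 0 < p)
    (hreach : ∃ P : N.Route, (∀ i, 0 < N.nodeCap (P.node i)) ∧ ∀ i, 0 < N.edgeCap (P.edge i)) :
    (∃ (R : N.RouteList) (x : Fin R.length → ℕ), EvacNetwork.IsSSEPSolution rank p R x) ∧
    (∃ L : N.Plan, EvacNetwork.IsCCRPSolution rank p L) ∧
    ∀ (R : N.RouteList) (x : Fin R.length → ℕ) (L : N.Plan),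
      EvacNetwork.IsSSEPSolution rank p R x → EvacNetwork.IsCCRPSolution rank p L →
        ((EvacNetwork.ssepPlan R x).evacTime : ℤ) = EvacNetwork.cet p R ∧
        (EvacNetwork.ssepPlan R x).evacTime ≤ L.evacTime :=
  mainTheorem1_general N rank hrank p hp hreach
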